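/- An algebra is a set $A$ together with a family of finitary operations on $A$; it is an *expanded group* if there is a (not necessarily commutative) group structure $(A,+,-,0)$ whose operations $+$, $-$, $0$ are among the operations of the algebra. Let $\mathbf{A}$ be a finite expanded group with universe $A$ and let $\mathrm{Con}(\mathbf{A})$ be its congruence lattice, ordered by inclusion. For $\eta \in \mathrm{Con}(\mathbf{A})$ put $\eta^+ := \bigwedge\{\theta : \eta < \theta\}$, and call $\eta$ meet irreducible if $\eta < \eta^+$. For intervals write $I[\alpha,\beta] \nearrow I[\gamma,\delta]$ if $\delta = \beta \vee \gamma$ and $\alpha = \beta \wedge \gamma$, and let projectivity of intervals be the smallest equivalence relation containing $\nearrow$. For $\alpha \prec \beta$ (that is, $\alpha<\beta$ with no congruence strictly between them) let $\Gamma(\alpha,\beta)$ be the join in $\mathrm{Con}(\mathbf{A})$ of all meet irreducible $\eta$ such that $I[\eta,\eta^+]$ is projective to $I[\alpha,\beta]$. Let $\overline{\mathbf{A}}$ be the algebra on $A$ whose operations are all finitary congruence preserving functions of $\mathbf{A}$, i.e. all $f\colon A^n \to A$ such that for every $\theta\in\mathrm{Con}(\mathbf{A})$, $(x_i,y_i)\in\theta$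 for all $i$ implies $(f(x),f(y))\in\theta$; it has the same congruences as $\mathbf{A}$. For congruences $\gamma,\beta$ of an algebra $\mathbf{B}$ let the commutator $[\gamma,\beta]_{\mathbf{B}}$ be the intersection of all congruences $\delta$ of $\mathbf{B}$ such that for all $n$, all $(n+1)$-ary term functions $t$ of $\mathbf{B}$, all $(a,b)\in\gamma$ and all $(c_1,d_1),\dots,(c_n,d_n)\in\beta$, $(t(a,c_1,\dots,c_n),t(a,d_1,\dots,d_n))\in\delta$ implies $(t(b,c_1,\dots,c_n),t(b,d_1,\dots,d_n))\in\delta$. The centralizer $(\alpha:\beta)_{\mathbf{B}}$ is the largest congruence $\gamma$ of $\mathbf{B}$ with $[\gamma,\beta]_{\mathbf{B}} \le \alpha$. **Theorem.** Let $\mathbf{A}$ be a finite expanded group and let $\alpha,\beta\in\mathrm{Con}(\mathbf{A})$ with $\alpha\prec\beta$. Then the centralizer $(\alpha:\beta)_{\overline{\mathbf{A}}}$ exists and equals $\Gamma(\alpha,\beta)$; that is, $\Gamma(\alpha,\beta)$ is the largest congruence $\gamma$ of $\overline{\mathbf{A}}$ with $[\gamma,\beta]_{\overline{\mathbf{A}}}\le\alpha$.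 -/

import Mathlib

namespace ExpandedGroups

open FirstOrder

/-! ### Lattice-theoretic notions in a complete lattice -/

section Lattice

variable {X : Type*} [CompleteLattice X]

/-- `η⁺`: the meet of all elements strictly above `η`. -/
def upper (η : X) : X := sInf {x | η < x}

/-- (Complete) meet irreducibility: `η` lies strictly below the meet of all elements
strictly above it. In particular `⊤` is not meet irreducible. -/
def MeetIrreducible (η : X) : Prop := η < upper η

/-- `I[a, b] ↗ I[c, d]`, where the pair `(a, b)` stands for the interval `I[a, b]`:
`d = b ⊔ c` and `a = b ⊓ c` (so that `a ≤ b` and `c ≤ d`). -/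
def TransposesUp (p q : X × X) : Prop := q.2 = p.2 ⊔ q.1 ∧ p.1 = p.2 ⊓ q.1

/-- Projectivity of intervals: the smallest equivalence relation containing `↗`. -/
def Projective (p q : X × X) : Prop := Relation.EqvGen TransposesUp p q

/-- `Γ(a, b)`: the join of all meet irreducible `η` such that `I[η, η⁺]` is projective
to `I[a, b]`. -/
def Gam (a b : X) : X := sSup {η | MeetIrreducible η ∧ Projective (η, upper η) (a, b)}

end Lattice

/-! ### Congruences of an algebra

An algebra is a structure on `A` for a first-order language `L` without relation symbols. -/

/-- A congruence: an equivalence relation compatible with all fundamental operations. -/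
@[ext]
structure Congruence (L : Language) (A : Type*) [L.Structure A] extends Setoid A where
  compat : ∀ {n : ℕ} (f : L.Functions n) (x y : Fin n → A),
    (∀ i, r (x i) (y i)) → r (Language.Structure.funMap f x) (Language.Structure.funMap f y)

section Congruence

variable {L : Language} {A : Type*} [L.Structure A]

/-- Congruences are ordered by inclusion of relations. -/
instance : PartialOrder (Congruence L A) where
  le θ ψ := ∀ ⦃x y : A⦄, θ.r x y → ψ.r x y
  le_refl _ _ _ h := h
  le_trans _ _ _ h₁ h₂ _ _ h := h₂ (h₁ h)
  le_antisymm θ ψ h₁ h₂ := by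
    apply Congruence.ext
    funext x y
    exact propext ⟨fun h => h₁ h, fun h => h₂ h⟩

/-- The infimum of a set of congruences is its intersection. -/
instance : InfSet (Congruence L A) where
  sInf S :=
    { r := fun x y => ∀ θ ∈ S, θ.r x y
      iseqv := ⟨fun x θ _ => θ.iseqv.refl x, fun h θ hθ => θ.iseqv.symm (h θ hθ),
        fun h₁ h₂ θ hθ => θ.iseqv.trans (h₁ θ hθ) (h₂ θ hθ)⟩
      compat := fun f x y h θ hθ => θ.compat f x y fun i => h i θ hθ }

/-- The congruence lattice. -/
instance : CompleteLattice (Congruence L A) :=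
  completeLatticeOfInf (Congruence L A) fun _ =>
    ⟨fun θ hθ _ _ h => h θ hθ, fun _ hψ _ _ h _ hθ => hψ hθ h⟩

/-- The term condition: `α` centralizes `β` modulo `δ`. -/
def Centralizes (α β δ : Congruence L A) : Prop :=
  ∀ (n : ℕ) (t : L.Term (Fin (n + 1))) (a b : A) (c d : Fin n → A),
    α.r a b → (∀ i, β.r (c i) (d i)) →
    δ.r (t.realize (Fin.cons a c : Fin (n + 1) → A)) (t.realize (Fin.cons a d : Fin (n + 1) → A)) →
    δ.r (t.realize (Fin.cons b c : Fin (n + 1) → A)) (t.realize (Fin.cons b d : Fin (n + 1) → A))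

/-- The term condition commutator `[α, β]`. -/
def commutator (α β : Congruence L A) : Congruence L A := sInf {δ | Centralizes α β δ}

/-- `γ` is the centralizer `(α : β)` of `β` over `α`: the largest congruence `γ`
with `[γ, β] ≤ α`. -/
def IsCentralizer (α β γ : Congruence L A) : Prop :=
  IsGreatest {γ' : Congruence L A | commutator γ' β ≤ α} γ

end Congruence

/-! ### The expansion by all congruence preserving functions -/

section Comp

variable (L : Language) (A : Type*) [L.Structure A]

/-- An `n`-ary function on `A` is congruence preserving if it is compatible with every
congruence of the algebra. -/
def CongruencePreserving {n : ℕ} (f : (Fin n → A) → A) : Prop :=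
  ∀ (θ : Congruence L A) (x y : Fin n → A), (∀ i, θ.r (x i) (y i)) → θ.r (f x) (f y)

/-- The language with one operation symbol for each finitary congruence preserving function. -/
def compLanguage : Language where
  Functions n := {f : (Fin n → A) → A // CongruencePreserving L A f}
  Relations _ := Empty

/-- The algebra on `A` whose fundamental operations are all congruence preserving functions. -/
instance compStructure : (compLanguage L A).Structure A where
  funMap f x := f.1 x
  RelMap r := r.elim

/-- The algebra and its expansion by all congruence preserving functions have the same
congruences: the isomorphism keeps the underlying relation. -/
def compCongruence : Congruence L A ≃o Congruence (compLanguage L A) A where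
  toFun θ := ⟨θ.toSetoid, fun f x y h => f.2 θ x y h⟩
  invFun ψ := ⟨ψ.toSetoid, fun f x y h =>
    ψ.compat (L := compLanguage L A)
      ⟨Language.Structure.funMap f, fun θ x y h => θ.compat f x y h⟩ x y h⟩
  left_inv _ := rfl
  right_inv _ := rfl
  map_rel_iff' := Iff.rfl

end Comp

/-- An algebra on an (additively written, not necessarily commutative) group `A` is an expanded
group if addition, negation and zero are among its fundamental operations. -/
class IsExpandedGroup (L : Language) (A : Type*) [AddGroup A] [L.Structure A] : Prop where
  exists_add : ∃ s : L.Functions 2, ∀ x : Fin 2 → A, Language.Structure.funMap s x = x 0 + x 1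
  exists_neg : ∃ s : L.Functions 1, ∀ x : Fin 1 → A, Language.Structure.funMap s x = -x 0
  exists_zero : ∃ s : L.Functions 0, ∀ x : Fin 0 → A, Language.Structure.funMap s x = 0

end ExpandedGroups

/-! Write Γ for `Gam α β` and σ for `joinOfIrreducibles α β`. By modularity every congruence lies
below Γ or above σ (`le_gam_or_joinOfIrreducibles_le`). Γ centralizes β modulo α: a meet irreducible
η trivially centralizes η⁺ modulo η, and the term condition is invariant under projectivity and
closed under joins in its first argument (`centralizesFun_gam`). For maximality, suppose γ ≰ Γ. Take
a join irreducible j with lower cover i, (i, j) projective to (α, β), and x in the zero class of j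
but not of i. `exists_preserving_into` gives a congruence preserving g into the zero class of σ with
g(0) = 0 and g(x) ≡ x mod i. Set F(u, v) = 0 if u is in the zero class of Γ, and g(v) otherwise. The
dichotomy makes F congruence preserving, and F refutes the term condition for γ. The work lies in g.
It rests on separating non-projective prime quotients (`exists_separating`): otherwise a diamond
would make them projective. -/

namespace ExpandedGroups

open FirstOrder

/-! ### Splitting a modular lattice by a projectivity class -/

section Order

variable {X : Type*} [CompleteLattice X]

/-- `b` is join irreducible with unique lower cover `a`. -/
def JoinIrreducibleOver (a b : X) : Prop := a < b ∧ ∀ c < b, c ≤ a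

theorem JoinIrreducibleOver.inf_eq {a b c : X} (h : JoinIrreducibleOver a b) (hac : a ≤ c)
    (hbc : ¬ b ≤ c) : b ⊓ c = a :=
  le_antisymm (h.2 _ (lt_of_le_of_ne inf_le_left fun e => hbc (inf_eq_left.1 e)))
    (le_inf h.1.le hac)

theorem JoinIrreducibleOver.not_le_sup [IsModularLattice X] {a b c : X}
    (h : JoinIrreducibleOver a b) (hbc : ¬ b ≤ c) : ¬ b ≤ a ⊔ c := by
  intro hb
  have h1 : (a ⊔ c) ⊓ b ≤ a ⊔ c ⊓ b := sup_inf_le_assoc_of_le c h.1.le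
  have h2 : c ⊓ b ≤ a := h.2 _ (lt_of_le_of_ne inf_le_right fun e => hbc (inf_eq_right.1 e))
  exact absurd (((le_inf hb le_rfl).trans h1).trans (sup_le le_rfl h2)) h.1.not_ge

theorem exists_joinIrreducibleOver [WellFoundedLT X] {a b : X} (h : a ⋖ b) :
    ∃ k, k ≤ b ∧ ¬ k ≤ a ∧ k ⊔ a = b ∧ JoinIrreducibleOver (k ⊓ a) k := by
  obtain ⟨k, ⟨hkb, hka⟩, hmin⟩ :=
    wellFounded_lt.has_min {k : X | k ≤ b ∧ ¬ k ≤ a} ⟨b, le_rfl, h.lt.not_ge⟩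
  refine ⟨k, hkb, hka, ?_, ?_, ?_⟩
  · exact (h.eq_or_eq le_sup_right (sup_le hkb h.le)).resolve_left
      fun e => hka (sup_eq_right.1 e)
  · exact lt_of_le_of_ne inf_le_left fun e => hka (inf_eq_left.1 e)
  · intro c hc
    refine le_inf hc.le ?_
    by_contra hca
    exact hmin c ⟨hc.le.trans hkb, hca⟩ hc

/-- The join of all join irreducible elements whose lower prime quotient is projective
to `(a, b)`. -/
def joinOfIrreducibles (a b : X) : X :=
  sSup {j | ∃ i, JoinIrreducibleOver i j ∧ Projective (i, j) (a, b)}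

/-- If some generator j of the join is not below x, an η ≥ i ⊔ x maximal with j ≰ η is meet
irreducible with η⁺ = j ⊔ η. So I[i, j] ↗ I[η, η⁺], and x ≤ η is below `Gam a b`. -/
theorem le_gam_or_joinOfIrreducibles_le [WellFoundedGT X] [IsModularLattice X] (a b x : X) :
    x ≤ Gam a b ∨ joinOfIrreducibles a b ≤ x := by
  by_contra! hx
  obtain ⟨hx, hs⟩ := hx
  apply hs
  refine sSup_le fun j hj => ?_
  obtain ⟨i, hij, hp⟩ := hj
  by_contra hjx
  obtain ⟨η, ⟨hη, hjη⟩, hmax⟩ :=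
    wellFounded_gt.has_min {η : X | i ⊔ x ≤ η ∧ ¬ j ≤ η} ⟨_, le_rfl, hij.not_le_sup hjx⟩
  have hup : upper η = j ⊔ η := by
    apply le_antisymm
    · exact sInf_le (lt_of_le_of_ne le_sup_right fun e => hjη (sup_eq_right.1 e.symm))
    · refine le_sInf fun z hz => sup_le ?_ (le_of_lt hz)
      by_contra hjz
      exact hmax z ⟨hη.trans (le_of_lt hz), hjz⟩ hz
  have hmi : MeetIrreducible η := by
    rw [MeetIrreducible, hup]
    exact lt_of_le_of_ne le_sup_right fun e => hjη (sup_eq_right.1 e.symm)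
  have ht : TransposesUp (i, j) (η, upper η) :=
    ⟨hup, (hij.inf_eq (le_sup_left.trans hη) hjη).symm⟩
  exact hx ((le_sup_right.trans hη).trans
    (le_sSup ⟨hmi, .trans _ _ _ (.symm _ _ (.rel _ _ ht)) hp⟩))

end Order

/-! ### Congruences of expanded groups permute and form a modular lattice -/

section Algebra

variable {L : Language} {A : Type*} [L.Structure A]

theorem Congruence.refl (θ : Congruence L A) (x : A) : θ.r x x := θ.iseqv.refl x

theorem Congruence.symm (θ : Congruence L A) {x y : A} (h : θ.r x y) : θ.r y x := θ.iseqv.symm h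

theorem Congruence.trans (θ : Congruence L A) {x y z : A} (h : θ.r x y) (h' : θ.r y z) :
    θ.r x z := θ.iseqv.trans h h'

theorem Congruence.inf_r {θ ψ : Congruence L A} {x y : A} :
    (θ ⊓ ψ).r x y ↔ θ.r x y ∧ ψ.r x y := by
  constructor
  · intro h
    exact ⟨(inf_le_left : θ ⊓ ψ ≤ θ) h, (inf_le_right : θ ⊓ ψ ≤ ψ) h⟩
  · rintro ⟨h1, h2⟩
    let κ : Congruence L A :=
      { r := fun x y => θ.r x y ∧ ψ.r x y
        iseqv := ⟨fun x => ⟨θ.refl x, ψ.refl x⟩, fun h => ⟨θ.symm h.1, ψ.symm h.2⟩,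
          fun h h' => ⟨θ.trans h.1 h'.1, ψ.trans h.2 h'.2⟩⟩
        compat := fun f x y h =>
          ⟨θ.compat f x y fun i => (h i).1, ψ.compat f x y fun i => (h i).2⟩ }
    have hκ : κ ≤ θ ⊓ ψ := le_inf (fun _ _ h => h.1) (fun _ _ h => h.2)
    exact hκ (show κ.r x y from ⟨h1, h2⟩)

instance [Finite A] : Finite (Congruence L A) :=
  Finite.of_injective (fun θ : Congruence L A => (θ.r : A → A → Prop))
    fun _ _ h => Congruence.ext h

variable [AddGroup A] [IsExpandedGroup L A]

theorem Congruence.add (θ : Congruence L A) {x x' y y' : A} (h : θ.r x x') (h' : θ.r y y') :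
    θ.r (x + y) (x' + y') := by
  obtain ⟨s, hs⟩ := IsExpandedGroup.exists_add (L := L) (A := A)
  have := θ.compat s ![x, y] ![x', y'] (by intro i; fin_cases i <;> simpa)
  simpa [hs] using this

theorem Congruence.neg (θ : Congruence L A) {x x' : A} (h : θ.r x x') : θ.r (-x) (-x') := by
  obtain ⟨s, hs⟩ := IsExpandedGroup.exists_neg (L := L) (A := A)
  have := θ.compat s ![x] ![x'] (by intro i; fin_cases i; simpa)
  simpa [hs] using this

theorem Congruence.sub (θ : Congruence L A) {x x' y y' : A} (h : θ.r x x') (h' : θ.r y y') :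
    θ.r (x - y) (x' - y') := by
  rw [sub_eq_add_neg, sub_eq_add_neg]
  exact θ.add h (θ.neg h')

/-- A reflexive relation compatible with the operations of an expanded group is a congruence. -/
def Congruence.ofReflexive (R : A → A → Prop) (hR : ∀ x, R x x)
    (hc : ∀ {n : ℕ} (f : L.Functions n) (x y : Fin n → A), (∀ i, R (x i) (y i)) →
      R (Language.Structure.funMap f x) (Language.Structure.funMap f y)) : Congruence L A :=
  have hadd : ∀ {x x' y y' : A}, R x x' → R y y' → R (x + y) (x' + y') := by
    intro x x' y y' h h'
    obtain ⟨s, hs⟩ := IsExpandedGroup.exists_add (L := L) (A := A)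
    have := hc s ![x, y] ![x', y'] (by intro i; fin_cases i <;> simpa)
    simpa [hs] using this
  have hneg : ∀ {x x' : A}, R x x' → R (-x) (-x') := by
    intro x x' h
    obtain ⟨s, hs⟩ := IsExpandedGroup.exists_neg (L := L) (A := A)
    have := hc s ![x] ![x'] (by intro i; fin_cases i; simpa)
    simpa [hs] using this
  -- Symmetry and transitivity come from the Mal'cev term x - y + z.
  { r := R
    iseqv := ⟨hR,
      fun {x y} h => by simpa using hadd (hadd (hR x) (hneg h)) (hR y),
      fun {x y z} h h' => by simpa using hadd (hadd h (hneg (hR y))) h'⟩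
    compat := hc }

theorem Congruence.sup_r {θ ψ : Congruence L A} {x y : A} :
    (θ ⊔ ψ).r x y ↔ ∃ z, θ.r x z ∧ ψ.r z y := by
  constructor
  · intro h
    let κ : Congruence L A := .ofReflexive (fun x y => ∃ z, θ.r x z ∧ ψ.r z y)
      (fun x => ⟨x, θ.refl x, ψ.refl x⟩) (by
        intro n f x y h
        choose z hz using h
        exact ⟨_, θ.compat f x z fun i => (hz i).1, ψ.compat f z y fun i => (hz i).2⟩)
    have hκ : θ ⊔ ψ ≤ κ :=
      sup_le (fun x y h => ⟨y, h, ψ.refl y⟩) (fun x y h => ⟨x, θ.refl x, h⟩)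
    exact hκ h
  · rintro ⟨z, h1, h2⟩
    exact Congruence.trans _ ((le_sup_left : θ ≤ θ ⊔ ψ) h1) ((le_sup_right : ψ ≤ θ ⊔ ψ) h2)

instance : IsModularLattice (Congruence L A) where
  sup_inf_le_assoc_of_le := by
    intro θ ψ κ h x y hxy
    obtain ⟨h1, h2⟩ := Congruence.inf_r.1 hxy
    obtain ⟨z, hz, hz'⟩ := Congruence.sup_r.1 h1
    exact Congruence.sup_r.2 ⟨z, hz, Congruence.inf_r.2 ⟨hz', κ.trans (κ.symm (h hz)) h2⟩⟩

end Algebra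

/-! ### The term condition and its invariance under projectivity -/

section Central

variable {L : Language} {A : Type*} [L.Structure A]

/-- The term condition for all congruence preserving functions. -/
def CentralizesFun (γ β δ : Congruence L A) : Prop :=
  ∀ (n : ℕ) (F : (Fin (n + 1) → A) → A), CongruencePreserving L A F →
    ∀ (a b : A) (c d : Fin n → A), γ.r a b → (∀ i, β.r (c i) (d i)) →
      δ.r (F (Fin.cons a c)) (F (Fin.cons a d)) → δ.r (F (Fin.cons b c)) (F (Fin.cons b d))

theorem congruencePreserving_realize {n : ℕ} (t : (compLanguage L A).Term (Fin n)) :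
    CongruencePreserving L A fun v : Fin n → A => t.realize v := by
  intro θ x y h
  induction t with
  | var i => exact h i
  | func f ts ih => exact f.2 θ _ _ ih

theorem centralizes_iff {γ β δ : Congruence L A} :
    Centralizes (compCongruence L A γ) (compCongruence L A β) (compCongruence L A δ) ↔
      CentralizesFun γ β δ := by
  constructor
  · intro h n F hF a b c d hab hcd
    exact h n (.func (l := n + 1) (⟨F, hF⟩ : (compLanguage L A).Functions (n + 1))
      fun i => .var i) a b c d hab hcd
  · intro h n t a b c d hab hcd
    exact h n _ (congruencePreserving_realize t) a b c d hab hcd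

theorem centralizes_commutator {M : Language} {B : Type*} [M.Structure B]
    (γ β : Congruence M B) : Centralizes γ β (commutator γ β) := by
  intro n t a b c d hab hcd h δ hδ
  exact hδ n t a b c d hab hcd (h δ hδ)

theorem cons_r {n : ℕ} (θ : Congruence L A) {a b : A} {c d : Fin n → A} (h : θ.r a b)
    (h' : ∀ i, θ.r (c i) (d i)) (i : Fin (n + 1)) :
    θ.r ((Fin.cons a c : Fin (n + 1) → A) i) ((Fin.cons b d : Fin (n + 1) → A) i) := by
  refine Fin.cases ?_ ?_ i
  · simpa using h
  · simpa using h'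

theorem CentralizesFun.self_left (γ β : Congruence L A) : CentralizesFun γ β γ := by
  intro n F hF a b c d hab _ h
  have h1 := hF γ _ _ (cons_r γ hab fun i => γ.refl (c i))
  have h2 := hF γ _ _ (cons_r γ hab fun i => γ.refl (d i))
  exact γ.trans (γ.symm h1) (γ.trans h h2)

theorem CentralizesFun.self_right (γ β : Congruence L A) : CentralizesFun γ β β :=
  fun _ _ hF _ b _ _ _ hcd _ => hF β _ _ (cons_r β (β.refl b) hcd)

theorem CentralizesFun.mono_right {γ β β' δ : Congruence L A} (h : CentralizesFun γ β δ)
    (hβ : β' ≤ β) : CentralizesFun γ β' δ :=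
  fun n F hF a b c d hab hcd => h n F hF a b c d hab fun i => hβ (hcd i)

theorem CentralizesFun.inf {γ β δ δ' : Congruence L A} (h : CentralizesFun γ β δ)
    (h' : CentralizesFun γ β δ') : CentralizesFun γ β (δ ⊓ δ') := by
  intro n F hF a b c d hab hcd hF'
  rw [Congruence.inf_r] at hF' ⊢
  exact ⟨h n F hF a b c d hab hcd hF'.1, h' n F hF a b c d hab hcd hF'.2⟩

theorem CentralizesFun.mono_left {γ γ' β δ : Congruence L A} (h : CentralizesFun γ β δ)
    (hγ : γ' ≤ γ) : CentralizesFun γ' β δ :=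
  fun n F hF a b c d hab => h n F hF a b c d (hγ hab)

variable [AddGroup A] [IsExpandedGroup L A]

theorem CentralizesFun.sup_left {γ γ' β δ : Congruence L A} (h : CentralizesFun γ β δ)
    (h' : CentralizesFun γ' β δ) : CentralizesFun (γ ⊔ γ') β δ := by
  intro n F hF a b c d hab hcd hF'
  obtain ⟨z, h1, h2⟩ := Congruence.sup_r.1 hab
  exact h' n F hF z b c d h2 hcd (h n F hF a z c d h1 hcd hF')

/-- The congruences `γ` satisfying the term condition are closed under joins. -/
theorem CentralizesFun.sSup_left [Finite A] {S : Set (Congruence L A)} {β δ : Congruence L A}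
    (h : ∀ γ ∈ S, CentralizesFun γ β δ) : CentralizesFun (sSup S) β δ := by
  obtain ⟨m, hm, hmax⟩ := wellFounded_gt.has_min {γ | CentralizesFun γ β δ}
    ⟨δ, CentralizesFun.self_left δ β⟩
  refine CentralizesFun.mono_left hm (sSup_le fun γ hγ => ?_)
  by_contra hγm
  exact hmax (m ⊔ γ) (CentralizesFun.sup_left hm (h γ hγ))
    (lt_of_le_of_ne le_sup_left fun e => hγm (sup_eq_left.1 e.symm))

/-- Subtracting F(a, ·) makes the premise hold exactly, so δ itself suffices; adding F(a, ·) back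
only needs its values to agree modulo δ'. -/
theorem CentralizesFun.mono {γ β δ δ' : Congruence L A} (h : CentralizesFun γ β δ)
    (hδ : δ ≤ δ') : CentralizesFun γ β δ' := by
  intro n F hF a b c d hab hcd hF'
  have hcp : CongruencePreserving L A fun v : Fin (n + 1) → A =>
      F v - F (Fin.cons a (Fin.tail v)) := by
    intro θ x y hxy
    exact θ.sub (hF θ _ _ hxy) (hF θ _ _ (cons_r θ (θ.refl a) fun i => hxy i.succ))
  have := h n _ hcp a b c d hab hcd (by simp)
  simpa using δ'.add (hδ this) hF'

theorem CentralizesFun.sup_right {γ β δ : Congruence L A} (h : CentralizesFun γ β δ) :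
    CentralizesFun γ (β ⊔ δ) δ := by
  intro n F hF a b c d hab hcd hF'
  choose e hce hed using fun i => Congruence.sup_r.1 (hcd i)
  have key (x : A) : δ.r (F (Fin.cons x e)) (F (Fin.cons x d)) :=
    hF δ _ _ (cons_r δ (δ.refl x) hed)
  exact δ.trans (h n F hF a b c e hab hce (δ.trans hF' (δ.symm (key a)))) (key b)

/-- Upwards, enlarge the modulus and then absorb it into the second argument. Downwards, restrict
the second argument and intersect with the trivial condition modulo `p.2`. -/
theorem TransposesUp.centralizesFun_iff {p q : Congruence L A × Congruence L A}
    (h : TransposesUp p q) (γ : Congruence L A) :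
    CentralizesFun γ p.2 p.1 ↔ CentralizesFun γ q.2 q.1 := by
  obtain ⟨h1, h2⟩ := h
  rw [h1, h2]
  constructor
  · intro hc
    exact (hc.mono inf_le_right).sup_right
  · intro hc
    exact (CentralizesFun.self_right γ p.2).inf (hc.mono_right le_sup_left)

theorem Projective.centralizesFun_iff {p q : Congruence L A × Congruence L A}
    (h : Projective p q) (γ : Congruence L A) :
    CentralizesFun γ p.2 p.1 ↔ CentralizesFun γ q.2 q.1 := by
  induction h with
  | rel _ _ h => exact h.centralizesFun_iff γ
  | refl _ => exact Iff.rfl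
  | symm _ _ _ ih => exact ih.symm
  | trans _ _ _ _ _ ih ih' => exact ih.trans ih'

theorem centralizesFun_gam [Finite A] (α β : Congruence L A) :
    CentralizesFun (Gam α β) β α :=
  CentralizesFun.sSup_left fun η hη =>
    (hη.2.centralizesFun_iff η).1 (CentralizesFun.self_left η (upper η))

/-- The commutator itself satisfies the term condition as a modulus, and `CentralizesFun.mono`
passes to any larger one. -/
theorem commutator_le_iff {γ β α : Congruence L A} :
    commutator (compCongruence L A γ) (compCongruence L A β) ≤ compCongruence L A α ↔
      CentralizesFun γ β α := by
  constructor
  · intro h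
    obtain ⟨ρ, hρ⟩ := (compCongruence L A).surjective
      (commutator (compCongruence L A γ) (compCongruence L A β))
    have hc := centralizes_commutator (compCongruence L A γ) (compCongruence L A β)
    rw [← hρ] at h hc
    exact (centralizes_iff.1 hc).mono ((compCongruence L A).le_iff_le.1 h)
  · intro h
    exact sInf_le (centralizes_iff.2 h)

end Central

/-! ### Separating non-projective prime quotients by unary functions -/

section Unary

variable {L : Language} {A : Type*} [L.Structure A]

variable (L) in
/-- Unary congruence preserving functions. -/
def PreservesCongruences (f : A → A) : Prop :=
  ∀ (θ : Congruence L A) (x y : A), θ.r x y → θ.r (f x) (f y)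

theorem CentralizesFun.binary {γ β δ : Congruence L A} (h : CentralizesFun γ β δ)
    {G : A → A → A}
    (hG : ∀ (θ : Congruence L A) (x x' y y' : A), θ.r x x' → θ.r y y' → θ.r (G x y) (G x' y'))
    {a b c d : A} (hab : γ.r a b) (hcd : β.r c d) (h' : δ.r (G a c) (G a d)) :
    δ.r (G b c) (G b d) :=
  h 1 (fun v => G (v 0) (v 1)) (fun θ _ _ hxy => hG θ _ _ _ _ (hxy 0) (hxy 1)) a b
    (fun _ => c) (fun _ => d) hab (fun _ => hcd) h'

variable [AddGroup A] [IsExpandedGroup L A]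

/-- Under the term condition a congruence preserving function has the same increments at
related base points. -/
theorem CentralizesFun.increment {γ β δ : Congruence L A} (h : CentralizesFun γ β δ)
    {f : A → A} (hf : PreservesCongruences L f) {a x : A} (ha : γ.r 0 a) (hx : β.r 0 x) :
    δ.r (f x - f 0) (f (a + x) - f a) := by
  -- This second difference vanishes whenever u = 0 or v = 0.
  have key := h.binary (G := fun u v => (f (u + v) - f u) - (f v - f 0))
    (fun θ u u' v v' hu hv => θ.sub (θ.sub (hf θ _ _ (θ.add hu hv)) (hf θ _ _ hu))
      (θ.sub (hf θ _ _ hv) (θ.refl _))) ha hx (by simp)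
  have := δ.add key (δ.refl (f x - f 0))
  simpa using this

/-- The congruence generated by `δ` and the pair `(u, v)`, described by congruence preserving
functions. -/
def principalOver (δ : Congruence L A) (u v : A) : Congruence L A :=
  .ofReflexive (fun s t => ∃ f : A → A, PreservesCongruences L f ∧ f u = s ∧ δ.r (f v) t)
    (fun x => ⟨fun _ => x, fun θ _ _ _ => θ.refl x, rfl, δ.refl x⟩) (by
      intro n g x y h
      choose f hf hu hv using h
      refine ⟨fun z => Language.Structure.funMap g fun i => f i z, ?_, ?_, ?_⟩
      · exact fun θ z w hzw => θ.compat g _ _ fun i => hf i θ z w hzw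
      · simp [hu]
      · exact δ.compat g _ _ hv)

theorem principalOver_r {δ : Congruence L A} {u v s t : A} :
    (principalOver δ u v).r s t ↔
      ∃ f : A → A, PreservesCongruences L f ∧ f u = s ∧ δ.r (f v) t := Iff.rfl

theorem le_principalOver (δ : Congruence L A) (u v : A) : δ ≤ principalOver δ u v :=
  fun s _ h => ⟨fun _ => s, fun θ _ _ _ => θ.refl s, rfl, h⟩

theorem principalOver_self (δ : Congruence L A) (u v : A) : (principalOver δ u v).r u v :=
  ⟨id, fun _ _ _ h => h, rfl, δ.refl v⟩

theorem principalOver_le {δ κ : Congruence L A} {u v : A} (h : δ ≤ κ) (h' : κ.r u v) :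
    principalOver δ u v ≤ κ := by
  rintro s t ⟨f, hf, rfl, ht⟩
  exact κ.trans (hf κ _ _ h') (h ht)

/-- Three elements pairwise spanning the same interval: a diamond makes its sides projective. -/
theorem projective_of_diamond {X : Type*} [CompleteLattice X] {d p q k : X} (hpq : p ⊓ q = d)
    (hpk : k ⊓ p = d) (hqk : k ⊓ q = d) (h1 : k ⊔ p = p ⊔ q) (h2 : k ⊔ q = p ⊔ q) :
    Projective (d, p) (d, q) := by
  have t1 : TransposesUp (d, p) (q, p ⊔ q) := ⟨rfl, hpq.symm⟩
  have t2 : TransposesUp (d, k) (q, p ⊔ q) := ⟨h2.symm, hqk.symm⟩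
  have t3 : TransposesUp (d, k) (p, p ⊔ q) := ⟨h1.symm, hpk.symm⟩
  have t4 : TransposesUp (d, q) (p, p ⊔ q) := ⟨sup_comm _ _, by rw [← hpq]; exact inf_comm _ _⟩
  exact .trans _ _ _ (.trans _ _ _ (.rel _ _ t1) (.symm _ _ (.rel _ _ t2)))
    (.trans _ _ _ (.rel _ _ t3) (.symm _ _ (.rel _ _ t4)))

/-- Two atoms over `δ` that are not projective: a pair of the join moved in both directions
generates the first atom. -/
theorem le_principalOver_of_not_projective {δ P Q : Congruence L A} (hP : δ ⋖ P) (hQ : δ ⋖ Q)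
    (hn : ¬ Projective (δ, P) (δ, Q)) {a a' x : A} (hx : P.r 0 x) (hx' : ¬ δ.r 0 x)
    (ha : Q.r a a') (ha' : ¬ δ.r a a') : P ≤ principalOver δ a (a' + x) := by
  by_contra hPK
  set K := principalOver δ a (a' + x) with hK
  have hδK : δ ≤ K := le_principalOver δ a (a' + x)
  have haK : K.r a (a' + x) := principalOver_self δ a (a' + x)
  have hPQ : P ⊓ Q = δ := by
    refine (hP.eq_or_eq (le_inf hP.le hQ.le) inf_le_left).resolve_right fun e => ?_
    have hle : P ≤ Q := inf_eq_left.1 e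
    have : P = Q := (hQ.eq_or_eq hP.le hle).resolve_left hP.lt.ne'
    exact hn (this ▸ .refl _)
  have hxP : P.r a' (a' + x) := by simpa using P.add (P.refl a') hx
  have hxδ : ¬ δ.r a' (a' + x) := fun h => hx' (by simpa using δ.add (δ.refl (-a')) h)
  have hKP : K ⊓ P = δ := (hP.eq_or_eq (le_inf hδK hP.le) inf_le_right).resolve_right
    fun e => hPK (inf_eq_right.1 e)
  have hKQ : K ⊓ Q = δ := by
    refine (hQ.eq_or_eq (le_inf hδK hQ.le) inf_le_right).resolve_right fun e => hxδ ?_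
    have hle : Q ≤ K := inf_eq_right.1 e
    rw [← hKP, Congruence.inf_r]
    exact ⟨K.trans (K.symm (hle ha)) haK, hxP⟩
  have hKPQ : K ≤ P ⊔ Q := principalOver_le (hP.le.trans le_sup_left)
    (Congruence.trans _ ((le_sup_right : Q ≤ P ⊔ Q) ha) ((le_sup_left : P ≤ P ⊔ Q) hxP))
  -- K now meets both P and Q in δ; joining to P ⊔ Q with each completes the forbidden diamond.
  have h2 : K ⊔ Q = P ⊔ Q := by
    refine le_antisymm (sup_le hKPQ le_sup_right) (sup_le ?_ le_sup_right)
    have hr : ((K ⊔ Q) ⊓ P).r a' (a' + x) := Congruence.inf_r.2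
      ⟨Congruence.trans _ ((le_sup_right : Q ≤ K ⊔ Q) (Q.symm ha))
        ((le_sup_left : K ≤ K ⊔ Q) haK), hxP⟩
    refine inf_eq_right.1 ((hP.eq_or_eq (le_inf (hδK.trans le_sup_left) hP.le)
      inf_le_right).resolve_left fun e => hxδ (e ▸ hr))
  have h1 : K ⊔ P = P ⊔ Q := by
    refine le_antisymm (sup_le hKPQ le_sup_left) (sup_le le_sup_right ?_)
    have hr : ((K ⊔ P) ⊓ Q).r a a' := Congruence.inf_r.2
      ⟨Congruence.trans _ ((le_sup_left : K ≤ K ⊔ P) haK)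
        ((le_sup_right : P ≤ K ⊔ P) (P.symm hxP)), ha⟩
    refine inf_eq_right.1 ((hQ.eq_or_eq (le_inf (hδK.trans le_sup_left) hQ.le)
      inf_le_right).resolve_left fun e => ha' (e ▸ hr))
  exact hn (projective_of_diamond hPQ hKP hKQ h1 h2)

/-- Separation over a common lower bound. -/
theorem exists_separating_of_covBy {δ P Q γ : Congruence L A} (hP : δ ⋖ P) (hQ : δ ⋖ Q)
    (hn : ¬ Projective (δ, P) (δ, Q)) (hγ : CentralizesFun γ P δ) {a a' x : A}
    (hx : P.r 0 x) (hx' : ¬ δ.r 0 x) (haγ : γ.r 0 a) (ha : Q.r a a') :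
    ∃ f : A → A, PreservesCongruences L f ∧ f 0 = 0 ∧ δ.r (f x) x ∧ δ.r (f a) (f a') := by
  by_cases ha' : δ.r a a'
  · exact ⟨id, fun _ _ _ h => h, rfl, δ.refl x, ha'⟩
  have hPQ : P ⊓ Q = δ := by
    refine (hP.eq_or_eq (le_inf hP.le hQ.le) inf_le_left).resolve_right fun e => ?_
    have : P = Q := (hQ.eq_or_eq hP.le (inf_eq_left.1 e)).resolve_left hP.lt.ne'
    exact hn (this ▸ .refl _)
  -- Since (0, x) lies in the principal congruence, f(a) = 0 and f(a' + x) ≡ x mod δ.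
  obtain ⟨f, hf, hfa, hfx⟩ := principalOver_r.1
    (le_principalOver_of_not_projective hP hQ hn hx hx' ha ha' hx)
  have hxP (z : A) : P.r z (z + x) := by simpa using P.add (P.refl z) hx
  have h1 : δ.r (f a') 0 := by
    rw [← hPQ, Congruence.inf_r]
    refine ⟨P.trans (hf P _ _ (hxP a')) (P.trans (hP.le hfx) (P.symm hx)), ?_⟩
    rw [← hfa]
    exact hf Q _ _ (Q.symm ha)
  have h2 : δ.r (f (a + x)) x := by
    rw [← hPQ, Congruence.inf_r]
    constructor
    · refine P.trans (hf P _ _ (P.symm (hxP a))) ?_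
      rw [hfa]
      exact hx
    · exact Q.trans (hf Q _ _ (Q.add ha (Q.refl x))) (hQ.le hfx)
  -- Centrality moves the increment from base point a to base point 0.
  have h3 : δ.r (f x - f 0) x := by
    refine δ.trans (hγ.increment hf haγ hx) ?_
    simpa [hfa] using h2
  refine ⟨fun z => f z - f 0, fun θ z w h => θ.sub (hf θ _ _ h) (θ.refl _), sub_self _, h3, ?_⟩
  refine δ.sub ?_ (δ.refl _)
  rw [hfa]
  exact δ.symm h1

theorem JoinIrreducibleOver.covBy_sup {X : Type*} [CompleteLattice X] [IsModularLattice X]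
    {i j c : X} (h : JoinIrreducibleOver i j) (hic : i ≤ c) (hjc : ¬ j ≤ c) :
    c ⋖ j ⊔ c := by
  have hij : i ⋖ j := ⟨h.1, fun z hz hz' => (h.2 z hz').not_gt hz⟩
  rw [← h.inf_eq hic hjc] at hij
  exact covBy_sup_of_inf_covBy_left hij

/-- Incomparable join irreducible congruences that are not projective can be separated. -/
theorem exists_separating {i j l k γ : Congruence L A} (hj : JoinIrreducibleOver i j)
    (hk : JoinIrreducibleOver l k) (hjk : ¬ j ≤ k) (hkj : ¬ k ≤ j)
    (hn : ¬ Projective (i, j) (l, k)) (hγ : CentralizesFun γ j i) {a a' x : A}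
    (hx : j.r 0 x) (hx' : ¬ i.r 0 x) (haγ : γ.r 0 a) (ha : k.r a a') :
    ∃ f : A → A, PreservesCongruences L f ∧ f 0 = 0 ∧ i.r (f x) x ∧ l.r (f a) (f a') := by
  -- Both quotients transpose up to covers of i ⊔ l, which reduces to a common lower bound.
  have hjδ : ¬ j ≤ i ⊔ l := hj.not_le_sup fun h => hjk (h.trans hk.1.le)
  have hkδ : ¬ k ≤ i ⊔ l := by
    rw [sup_comm]
    exact hk.not_le_sup fun h => hkj (h.trans hj.1.le)
  have hji := hj.inf_eq le_sup_left hjδ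
  have hkl := hk.inf_eq le_sup_right hkδ
  have tj : TransposesUp (i, j) (i ⊔ l, j ⊔ (i ⊔ l)) := ⟨rfl, hji.symm⟩
  have tk : TransposesUp (l, k) (i ⊔ l, k ⊔ (i ⊔ l)) := ⟨rfl, hkl.symm⟩
  obtain ⟨f, hf, hf0, hfx, hfa⟩ := exists_separating_of_covBy (hj.covBy_sup le_sup_left hjδ)
    (hk.covBy_sup le_sup_right hkδ)
    (fun h => hn (.trans _ _ _ (.rel _ _ tj) (.trans _ _ _ h (.symm _ _ (.rel _ _ tk)))))
    ((tj.centralizesFun_iff γ).1 hγ) ((le_sup_left : j ≤ j ⊔ (i ⊔ l)) hx)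
    (fun h => hx' (hji ▸ Congruence.inf_r.2 ⟨hx, h⟩)) haγ ((le_sup_left : k ≤ k ⊔ (i ⊔ l)) ha)
  refine ⟨f, hf, hf0, ?_, ?_⟩
  · rw [← hji]
    refine Congruence.inf_r.2 ⟨j.trans ?_ hx, hfx⟩
    simpa [hf0] using hf j _ _ (j.symm hx)
  · rw [← hkl]
    exact Congruence.inf_r.2 ⟨hf k _ _ ha, hfa⟩

/-- Nonzero elements of a quotient transfer along transposition, with the same functions
fixing them. -/
theorem TransposesUp.transfer {p q : Congruence L A × Congruence L A} (h : TransposesUp p q)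
    (T : Set (A → A)) (hT : ∀ f ∈ T, PreservesCongruences L f ∧ f 0 = 0) :
    (∀ x, p.2.r 0 x → ¬ p.1.r 0 x → ∃ x', q.2.r 0 x' ∧ ¬ q.1.r 0 x' ∧
      ∀ f ∈ T, (p.1.r (f x) x ↔ q.1.r (f x') x')) ∧
    (∀ x, q.2.r 0 x → ¬ q.1.r 0 x → ∃ x', p.2.r 0 x' ∧ ¬ p.1.r 0 x' ∧
      ∀ f ∈ T, (q.1.r (f x) x ↔ p.1.r (f x') x')) := by
  obtain ⟨a, b⟩ := p
  obtain ⟨c, d⟩ := q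
  obtain ⟨h1, h2⟩ := h
  simp only at h1 h2 ⊢
  subst h1 h2
  have key (x : A) (hx : b.r 0 x) (f : A → A) (hf : f ∈ T) :
      (b ⊓ c).r (f x) x ↔ c.r (f x) x := by
    rw [Congruence.inf_r, and_iff_right]
    have := (hT f hf).1 b _ _ (b.symm hx)
    rw [(hT f hf).2] at this
    exact b.trans this hx
  constructor
  · intro x hx hx'
    exact ⟨x, (le_sup_left : b ≤ b ⊔ c) hx, fun h => hx' (Congruence.inf_r.2 ⟨hx, h⟩), key x hx⟩
  · intro x hx hx'
    obtain ⟨z, hz, hzx⟩ := Congruence.sup_r.1 hx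
    refine ⟨z, hz, fun h => hx' (c.trans (Congruence.inf_r.1 h).2 hzx), fun f hf => ?_⟩
    rw [key z hz f hf]
    have hfz := (hT f hf).1 c _ _ hzx
    exact ⟨fun h => c.trans hfz (c.trans h (c.symm hzx)),
      fun h => c.trans (c.symm hfz) (c.trans h hzx)⟩

theorem Projective.transfer {p q : Congruence L A × Congruence L A} (h : Projective p q)
    (T : Set (A → A)) (hT : ∀ f ∈ T, PreservesCongruences L f ∧ f 0 = 0) :
    (∀ x, p.2.r 0 x → ¬ p.1.r 0 x → ∃ x', q.2.r 0 x' ∧ ¬ q.1.r 0 x' ∧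
      ∀ f ∈ T, (p.1.r (f x) x ↔ q.1.r (f x') x')) ∧
    (∀ x, q.2.r 0 x → ¬ q.1.r 0 x → ∃ x', p.2.r 0 x' ∧ ¬ p.1.r 0 x' ∧
      ∀ f ∈ T, (q.1.r (f x) x ↔ p.1.r (f x') x')) := by
  induction h with
  | rel _ _ h => exact h.transfer T hT
  | refl _ => exact ⟨fun x h h' => ⟨x, h, h', fun _ _ => Iff.rfl⟩,
      fun x h h' => ⟨x, h, h', fun _ _ => Iff.rfl⟩⟩
  | symm _ _ _ ih => exact ih.symm
  | trans _ _ _ _ _ ih ih' =>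
    constructor
    · intro x h h'
      obtain ⟨y, hy, hy', e⟩ := ih.1 x h h'
      obtain ⟨z, hz, hz', e'⟩ := ih'.1 y hy hy'
      exact ⟨z, hz, hz', fun f hf => (e f hf).trans (e' f hf)⟩
    · intro x h h'
      obtain ⟨y, hy, hy', e⟩ := ih'.2 x h h'
      obtain ⟨z, hz, hz', e'⟩ := ih.2 y hy hy'
      exact ⟨z, hz, hz', fun f hf => (e f hf).trans (e' f hf)⟩

end Unary

/-! ### Congruence preserving functions that refute the term condition -/

section Main

variable {L : Language} {A : Type*} [L.Structure A]

/-- Zero-preserving congruence preserving functions fixing `x` modulo `i`. -/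
def fixingFunctions [Zero A] (i : Congruence L A) (x : A) : Set (A → A) :=
  {f | PreservesCongruences L f ∧ f 0 = 0 ∧ i.r (f x) x}

theorem comp_mem_fixingFunctions [Zero A] {i : Congruence L A} {x : A} {f g : A → A}
    (hf : f ∈ fixingFunctions i x) (hg : g ∈ fixingFunctions i x) :
    f ∘ g ∈ fixingFunctions i x :=
  ⟨fun θ _ _ h => hf.1 θ _ _ (hg.1 θ _ _ h), by simp [hf.2.1, hg.2.1],
    i.trans (hf.1 i _ _ hg.2.2) hf.2.2⟩

theorem id_mem_fixingFunctions [Zero A] (i : Congruence L A) (x : A) :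
    id ∈ fixingFunctions i x :=
  ⟨fun _ _ _ h => h, rfl, i.refl x⟩

variable [AddGroup A] [IsExpandedGroup L A] [Finite A]

/-- Pairs in a congruence below `Gam α β` that does not contain `joinOfIrreducibles α β` can be
moved into `joinOfIrreducibles α β`. -/
theorem exists_collapsing {α β i j : Congruence L A}
    (hp : Projective (i, j) (α, β)) {x : A} (hx : j.r 0 x) (hx' : ¬ i.r 0 x)
    (θ : Congruence L A) (hθ : θ ≤ Gam α β) (hσ : ¬ joinOfIrreducibles α β ≤ θ) {y y' : A}
    (hy : (Gam α β).r 0 y) (hyy : θ.r y y') :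
    ∃ f ∈ fixingFunctions i x, (joinOfIrreducibles α β).r (f y) (f y') := by
  induction θ using WellFoundedLT.induction generalizing y y' with
  | ind θ ih =>
  by_cases hle : θ ≤ joinOfIrreducibles α β
  · exact ⟨id, id_mem_fixingFunctions i x, hle hyy⟩
  -- With ζ above θ ⊓ σ, the join irreducible k splitting off θ over ζ is not below σ, so its
  -- quotient is not projective to (α, β).
  obtain ⟨ζ, hζ, hζθ⟩ : ∃ ζ, θ ⊓ joinOfIrreducibles α β ≤ ζ ∧ ζ ⋖ θ :=
    exists_le_covBy_of_lt (lt_of_le_of_ne inf_le_left fun e => hle (inf_eq_left.1 e))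
  obtain ⟨k, hkθ, hkζ, hsup, hk⟩ := exists_joinIrreducibleOver hζθ
  have hkσ : ¬ k ≤ joinOfIrreducibles α β := fun h => hkζ ((le_inf hkθ h).trans hζ)
  obtain ⟨j', ⟨i', hj', hp'⟩, hj'k⟩ :
      ∃ j' ∈ {j | ∃ i, JoinIrreducibleOver i j ∧ Projective (i, j) (α, β)}, ¬ j' ≤ k := by
    by_contra! hall
    exact hσ ((sSup_le hall).trans hkθ)
  have hkj' : ¬ k ≤ j' := fun h => hkσ (h.trans (le_sSup ⟨i', hj', hp'⟩))
  have hn : ¬ Projective (i', j') (k ⊓ ζ, k) := fun h =>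
    hkσ (le_sSup ⟨_, hk, .trans _ _ _ (.symm _ _ h) hp'⟩)
  obtain ⟨x', hxj, hxi, hxf⟩ := ((Projective.transfer (.trans _ _ _ hp (.symm _ _ hp'))
    {f | PreservesCongruences L f ∧ f 0 = 0} fun _ h => h).1 x hx hx' :)
  rw [← hsup, sup_comm] at hyy
  obtain ⟨z, hyz, hzy⟩ := Congruence.sup_r.1 hyy
  obtain ⟨f, hf, hf0, hfx, hfz⟩ := exists_separating hj' hk hj'k hkj' hn
    ((hp'.centralizesFun_iff _).2 (centralizesFun_gam α β)) hxj hxi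
    (Congruence.trans _ hy (hθ (hζθ.le hyz))) hzy
  have hfm : f ∈ fixingFunctions i x := ⟨hf, hf0, (hxf f ⟨hf, hf0⟩).2 hfx⟩
  have hfy : (Gam α β).r 0 (f y) := by simpa [hf0] using hf _ _ _ hy
  -- As f sends the k-part of the pair into k ⊓ ζ, the pair (f y, f y') lies in ζ.
  obtain ⟨g, hg, hgy⟩ := ih ζ hζθ.lt (hζθ.le.trans hθ) (fun h => hσ (h.trans hζθ.le)) hfy
    (ζ.trans (hf ζ _ _ hyz) ((inf_le_right : k ⊓ ζ ≤ ζ) hfz))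
  exact ⟨g ∘ f, comp_mem_fixingFunctions hg hfm, hgy⟩

/-- One function moves all such pairs simultaneously. -/
theorem exists_collapsing_all {α β i j : Congruence L A}
    (hp : Projective (i, j) (α, β)) {x : A} (hx : j.r 0 x) (hx' : ¬ i.r 0 x) :
    ∃ f ∈ fixingFunctions i x, ∀ θ ≤ Gam α β, ¬ joinOfIrreducibles α β ≤ θ →
      ∀ y y', (Gam α β).r 0 y → θ.r y y' → (joinOfIrreducibles α β).r (f y) (f y') := by
  classical
  have := Fintype.ofFinite A
  suffices h : ∀ s : Finset (A × A), ∃ f ∈ fixingFunctions i x, ∀ p ∈ s, ∀ θ ≤ Gam α β,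
      ¬ joinOfIrreducibles α β ≤ θ → (Gam α β).r 0 p.1 → θ.r p.1 p.2 →
      (joinOfIrreducibles α β).r (f p.1) (f p.2) by
    obtain ⟨f, hf, h⟩ := h Finset.univ
    exact ⟨f, hf, fun θ hθ hσ y y' hy hyy => h (y, y') (Finset.mem_univ _) θ hθ hσ hy hyy⟩
  intro s
  induction s using Finset.induction_on with
  | empty => exact ⟨id, id_mem_fixingFunctions i x, by simp⟩
  | insert p s _ ih =>
    obtain ⟨f, hf, hfs⟩ := ih
    by_cases hpθ : ∃ θ ≤ Gam α β, ¬ joinOfIrreducibles α β ≤ θ ∧ (Gam α β).r 0 p.1 ∧ θ.r p.1 p.2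
    · obtain ⟨θ, hθ, hσ, hp1, hp2⟩ := hpθ
      have hfp : (Gam α β).r 0 (f p.1) := by simpa [hf.2.1] using hf.1 _ _ _ hp1
      obtain ⟨g, hg, hgp⟩ := exists_collapsing hp hx hx' θ hθ hσ hfp (hf.1 θ _ _ hp2)
      refine ⟨g ∘ f, comp_mem_fixingFunctions hg hf, fun q hq θ' hθ' hσ' hq1 hq2 => ?_⟩
      rcases Finset.mem_insert.1 hq with rfl | hq
      · exact hgp
      -- Pairs already moved into σ stay there, since g preserves σ.
      · exact hg.1 _ _ _ (hfs q hq θ' hθ' hσ' hq1 hq2)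
    · refine ⟨f, hf, fun q hq θ hθ hσ hq1 hq2 => ?_⟩
      rcases Finset.mem_insert.1 hq with rfl | hq
      · exact absurd ⟨θ, hθ, hσ, hq1, hq2⟩ hpθ
      · exact hfs q hq θ hθ hσ hq1 hq2

/-- A congruence preserving function into the zero class of `joinOfIrreducibles α β` that does
not annihilate the quotient of a join irreducible congruence. -/
theorem exists_preserving_into {α β i j : Congruence L A} (hj : JoinIrreducibleOver i j)
    (hp : Projective (i, j) (α, β)) {x : A} (hx : j.r 0 x) (hx' : ¬ i.r 0 x) :
    ∃ g ∈ fixingFunctions i x, ∀ y, (joinOfIrreducibles α β).r 0 (g y) := by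
  classical
  obtain ⟨h, hh, hcol⟩ := exists_collapsing_all hp hx hx'
  set σ := joinOfIrreducibles α β with hσdef
  have hjσ : j ≤ σ := le_sSup ⟨i, hj, hp⟩
  -- Congruences above σ are respected because g maps into one σ-class. Any other θ is below Γ, so
  -- it respects the outer case split; it respects the inner one because h collapses θ-pairs in the
  -- zero class of Γ into σ.
  let g : A → A := fun y => if (Gam α β).r 0 y then (if σ.r 0 (h y) then h y else 0) else x
  have hgσ (y : A) : σ.r 0 (g y) := by
    simp only [g]
    split_ifs with h1 h2
    · exact h2
    · exact σ.refl 0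
    · exact hjσ hx
  refine ⟨g, ⟨fun θ y y' hyy => ?_, ?_, ?_⟩, hgσ⟩
  · by_cases hσ : σ ≤ θ
    · exact hσ (σ.trans (σ.symm (hgσ y)) (hgσ y'))
    have hθ : θ ≤ Gam α β := (le_gam_or_joinOfIrreducibles_le α β θ).resolve_right hσ
    have hiff : (Gam α β).r 0 y ↔ (Gam α β).r 0 y' :=
      ⟨fun h => Congruence.trans _ h (hθ hyy),
        fun h => Congruence.trans _ h (Congruence.symm _ (hθ hyy))⟩
    by_cases hy : (Gam α β).r 0 y
    · have hc := hcol θ hθ hσ y y' hy hyy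
      have hiff' : σ.r 0 (h y) ↔ σ.r 0 (h y') :=
        ⟨fun h => σ.trans h hc, fun h => σ.trans h (σ.symm hc)⟩
      simp only [g, ← hiff, ← hiff', hy, if_true]
      split_ifs
      · exact hh.1 θ _ _ hyy
      · exact θ.refl 0
    · simp only [g, ← hiff, hy, if_false]
      exact θ.refl x
  · simp [g, hh.2.1]
  · have hxσ : σ.r 0 (h x) := by
      have := hh.1 σ _ _ (hjσ hx)
      rwa [hh.2.1] at this
    simp only [g, hxσ, if_true]
    split_ifs
    · exact hh.2.2
    · exact i.refl x

theorem le_gam_of_centralizesFun {α β γ : Congruence L A} (hαβ : α ⋖ β)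
    (h : CentralizesFun γ β α) : γ ≤ Gam α β := by
  classical
  by_contra hγ
  obtain ⟨j, -, hjα, hsup, hj⟩ := exists_joinIrreducibleOver hαβ
  have hp : Projective (j ⊓ α, j) (α, β) := .rel _ _ ⟨hsup.symm, rfl⟩
  obtain ⟨x, hx, hx'⟩ : ∃ x, j.r 0 x ∧ ¬ (j ⊓ α).r 0 x := by
    by_contra! hall
    refine hj.1.not_ge fun u v huv => ?_
    have := Congruence.add _ (Congruence.refl _ u)
      (hall (-u + v) (by simpa using j.add (j.refl (-u)) huv))
    simpa using this
  obtain ⟨c, hc, hc'⟩ : ∃ c, γ.r 0 c ∧ ¬ (Gam α β).r 0 c := by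
    by_contra! hall
    refine hγ fun u v huv => ?_
    have := Congruence.add _ (Congruence.refl _ u)
      (hall (-u + v) (by simpa using γ.add (γ.refl (-u)) huv))
    simpa using this
  obtain ⟨g, hg, hgσ⟩ := exists_preserving_into hj hp hx hx'
  set σ := joinOfIrreducibles α β
  let F : A → A → A := fun u v => if (Gam α β).r 0 u then 0 else g v
  have hFσ (u v : A) : σ.r 0 (F u v) := by
    simp only [F]
    split_ifs
    · exact σ.refl 0
    · exact hgσ v
  have hF (θ : Congruence L A) (u u' v v' : A) (hu : θ.r u u') (hv : θ.r v v') :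
      θ.r (F u v) (F u' v') := by
    rcases le_gam_or_joinOfIrreducibles_le α β θ with hθ | hσ
    · have hiff : (Gam α β).r 0 u ↔ (Gam α β).r 0 u' :=
        ⟨fun h => Congruence.trans _ h (hθ hu),
          fun h => Congruence.trans _ h (Congruence.symm _ (hθ hu))⟩
      simp only [F, ← hiff]
      split_ifs
      · exact θ.refl 0
      · exact hg.1 θ _ _ hv
    · exact hσ (σ.trans (σ.symm (hFσ u v)) (hFσ u' v'))
  -- F(0, 0) = F(0, x) = 0, whereas F(c, 0) = 0 and F(c, x) = g(x) ≡ x, which is not 0 modulo j ⊓ α.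
  have hcen := ((hp.centralizesFun_iff γ).2 h).binary hF hc hx
    (by simp [F])
  simp only [F, hc', if_false, hg.2.1] at hcen
  exact hx' (Congruence.trans _ hcen hg.2.2)

end Main

end ExpandedGroups

theorem mainTheorem10 (L : FirstOrder.Language) [L.IsAlgebraic] (A : Type*) [Finite A]
    [AddGroup A] [L.Structure A] [ExpandedGroups.IsExpandedGroup L A]
    (α β : ExpandedGroups.Congruence L A) (hαβ : α ⋖ β) :
    ExpandedGroups.IsCentralizer
      (ExpandedGroups.compCongruence L A α)
      (ExpandedGroups.compCongruence L A β)
      (ExpandedGroups.compCongruence L A (ExpandedGroups.Gam α β)) := by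
  refine ⟨ExpandedGroups.commutator_le_iff.2 (ExpandedGroups.centralizesFun_gam α β), ?_⟩
  intro γ' hγ'
  obtain ⟨γ, rfl⟩ := (ExpandedGroups.compCongruence L A).surjective γ'
  exact (ExpandedGroups.compCongruence L A).le_iff_le.2
    (ExpandedGroups.le_gam_of_centralizesFun hαβ (ExpandedGroups.commutator_le_iff.1 hγ'))
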